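/- Let $(T,d)$ be a compact metric space with Borel $\sigma$-algebra $\Sigma$, and let $\mu:\Sigma\to[0,\infty)$ be a finite regular $\sigma$-additive measure with $\mu(\{t\})=0$ for every $t\in T$. Let $X$ be a Banach lattice with order continuous norm, and let $cwk(X)$ be the family of all nonempty convex weakly compact subsets of $X$. An $(o)$-sequence is a decreasing sequence $(b_n)_n$ in $X$ with $\bigwedge_n b_n=0$. A gauge is a map $\gamma:T\to(0,\infty)$. A partition of $E\in\Sigma$ is a finite family $\Pi=\{(E_i,t_i):i=1,\dots,k\}$ with $t_i\in T$, $E_i\in\Sigma$, $\mu(E_i\cap E_j)=0$ for $i\ne j$ and $\bigcup_i E_i=E$; it is $\gamma$-fine if $d(w,t_i)<\gamma(t_i)$ for all $w\in E_i$ and all $i$. For $F:T\to cwk(X)$ put $\Sigma_\Pi(F)=\sum_{i}F(t_i)\,\mu(E_i)$ (Minkowski operations), and for $C\subset X$, $b\in X$ put $\mathcal U(C,b)=\{z\in X: |z-y|\le b\text{ for some }y\in C\}$. The map $F$ is oH-integrable if for every $E\in\Sigma$ there are $J_E\in cwk(X)$, an $(o)$-sequence $(b_n)_n$ in $X$ and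 a sequence $(\gamma_n)_n$ of gauges such that, for every $n$ and every $\gamma_n$-fine partition $\Pi$ of $E$, $$\Sigma_\Pi(F)\subset\mathcal U(J_E,b_n)\quad\text{and}\quad J_E\subset\mathcal U(\Sigma_\Pi(F),b_n).$$ **Lemma.** Let $F:T\to cwk(X)$ be any map. Then $F$ is oH-integrable if and only if there exist an $(o)$-sequence $(b_n)_n$ in $X$ and a sequence $(\gamma_n)_n$ of gauges such that, for every $n$ and every pair $\Pi,\Pi'$ of $\gamma_n$-fine partitions of $T$, $$\Sigma_\Pi(F)\subset\mathcal U(\Sigma_{\Pi'}(F),b_n).$$ -/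

import Mathlib

open scoped Pointwise

namespace OrderHenstock

/-- The norm is order continuous: every nonempty downward directed set with infimum `0`
contains elements of arbitrarily small norm. -/
def OrderContinuousNorm (X : Type*) [NormedAddCommGroup X] [Lattice X] : Prop :=
  ∀ D : Set X, D.Nonempty → DirectedOn (fun x y => y ≤ x) D → IsGLB D 0 →
    ∀ ε : ℝ, 0 < ε → ∃ x ∈ D, ‖x‖ < ε

/-- The family `cwk(X)` of nonempty convex weakly compact subsets of `X`. -/
def cwk (X : Type*) [NormedAddCommGroup X] [NormedSpace ℝ X] : Set (Set X) :=
  {A | A.Nonempty ∧ Convex ℝ A ∧ IsCompact (toWeakSpace ℝ X '' A)}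

/-- An `(o)`-sequence: a decreasing sequence with infimum `0`. -/
def IsOSeq {X : Type*} [AddCommGroup X] [Lattice X] (b : ℕ → X) : Prop :=
  Antitone b ∧ IsGLB (Set.range b) 0

/-- `U(C, b)`, the set of all `z` with `|z - y| ≤ b` for some `y ∈ C`. -/
def orderNhd {X : Type*} [AddCommGroup X] [Lattice X] (C : Set X) (b : X) : Set X :=
  {z | ∃ y ∈ C, |z - y| ≤ b}

/-- A gauge: a strictly positive real function on `T`. -/
def IsGauge {T : Type*} (γ : T → ℝ) : Prop := ∀ t, 0 < γ t

/-- A (free, i.e. McShane type) partition of `E ⊆ T`: finitely many pairs `(E i, t i)` of a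
measurable set and a tag in `T`; the sets overlap in null sets only and their union is `E`.
The tags need lie neither in the corresponding sets nor in `E`. -/
structure Partition {T : Type*} [MeasurableSpace T] (μ : MeasureTheory.Measure T)
    (E : Set T) where
  /-- the number of pairs -/
  size : ℕ
  /-- the sets -/
  part : Fin size → Set T
  /-- the tags -/
  tag : Fin size → T
  measurableSet_part : ∀ i, MeasurableSet (part i)
  null_inter : ∀ i j, i ≠ j → μ (part i ∩ part j) = 0
  iUnion_part : ⋃ i, part i = E

/-- `γ`-fineness: `d(w, t i) < γ (t i)` for all `w ∈ E i` and all `i`. -/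
def Partition.IsFine {T : Type*} [MetricSpace T] [MeasurableSpace T]
    {μ : MeasureTheory.Measure T} {E : Set T} (P : Partition μ E) (γ : T → ℝ) : Prop :=
  ∀ i, ∀ w ∈ P.part i, dist w (P.tag i) < γ (P.tag i)

/-- The Riemann sum `Σ_Π(F) = ∑ i, F (t i) μ(E i)`, with the Minkowski operations. -/
noncomputable def Partition.riemannSum {T X : Type*} [MeasurableSpace T]
    [NormedAddCommGroup X] [NormedSpace ℝ X] {μ : MeasureTheory.Measure T} {E : Set T}
    (P : Partition μ E) (F : T → cwk X) : Set X :=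
  ∑ i, μ.real (P.part i) • (F (P.tag i) : Set X)

/-- oH-integrability of a multifunction `F : T → cwk(X)`: over every measurable `E ⊆ T` there is
an order Henstock integral `J ∈ cwk(X)`. -/
def OHIntegrable {T X : Type*} [MetricSpace T] [MeasurableSpace T]
    [NormedAddCommGroup X] [NormedSpace ℝ X] [Lattice X]
    (μ : MeasureTheory.Measure T) (F : T → cwk X) : Prop :=
  ∀ E : Set T, MeasurableSet E →
    ∃ J ∈ cwk X, ∃ b : ℕ → X, IsOSeq b ∧ ∃ γ : ℕ → T → ℝ, (∀ n, IsGauge (γ n)) ∧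
      ∀ n, ∀ P : Partition μ E, P.IsFine (γ n) →
        P.riemannSum F ⊆ orderNhd J (b n) ∧ J ⊆ orderNhd (P.riemannSum F) (b n)

end OrderHenstock

open Filter Topology Set

namespace OrderHenstock

/-! ### Weak limits and weakly compact convex sets -/

section WeakCompactness

variable {X : Type*} [NormedAddCommGroup X] [NormedSpace ℝ X]

/-! If `F` is integrable, two fine Riemann sums over `T` are compared through the integral, at the
cost of doubling the `(o)`-sequence. Conversely, extend two fine partitions of `E` by one fine
partition of the complement. The common summand is weakly compact and cancels
(`subset_of_add_subset_add`), so the Cauchy estimate holds on `E` with the same `b n` and `γ n`.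
Take Riemann sums `K n` along increasingly fine partitions and let `J` be the intersection of the
sets `orderNhd (K n) (b n)`. Order continuity gives `‖b n‖ → 0`, so `J` is norm-approximated by
weakly compact sets and is itself weakly compact. Weak limits along an ultrafilter of selections
from the `K m` lie in `J`; this makes `J` nonempty and large enough to be the integral
(`exists_limit_of_cauchy`). -/

theorem isClosed_toWeakSpace_image {s : Set X} (hs : Convex ℝ s) (hc : IsClosed s) :
    IsClosed (toWeakSpace ℝ X '' s) := by
  have h := hs.toWeakSpace_closure ℝ
  rw [hc.closure_eq] at h
  rw [h]
  exact isClosed_closure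

theorem mem_of_tendsto_toWeakSpace {ι : Type*} {l : Filter ι} [l.NeBot] {s : Set X}
    (hs : Convex ℝ s) (hc : IsClosed s) {y : ι → X} {z : X}
    (hy : Tendsto (fun i => toWeakSpace ℝ X (y i)) l (𝓝 (toWeakSpace ℝ X z)))
    (hmem : ∀ᶠ i in l, y i ∈ s) : z ∈ s := by
  obtain ⟨w, hw, hwz⟩ := (isClosed_toWeakSpace_image hs hc).mem_of_tendsto hy
    (hmem.mono fun i hi => mem_image_of_mem _ hi)
  rwa [← (toWeakSpace ℝ X).injective hwz]

theorem tendsto_toWeakSpace_iff {ι : Type*} {l : Filter ι} {y : ι → X} {z : X} :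
    Tendsto (fun i => toWeakSpace ℝ X (y i)) l (𝓝 (toWeakSpace ℝ X z)) ↔
      ∀ f : StrongDual ℝ X, Tendsto (fun i => f (y i)) l (𝓝 (f z)) :=
  WeakBilin.tendsto_iff_forall_eval_tendsto (topDualPairing ℝ X).flip fun _ _ hxy =>
    (SeparatingDual.eq_iff_forall_dual_eq (R := ℝ)).2 fun f => LinearMap.congr_fun hxy f

/-- A weak form of Grothendieck's criterion: along an ultrafilter, a family which is
uniformly approximated in norm by weakly compact sets converges weakly. -/
theorem exists_tendsto_toWeakSpace_of_approx [CompleteSpace X] {ι : Type*} (U : Ultrafilter ι)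
    {y : ι → X} {K : ℕ → Set X} (hK : ∀ n, IsCompact (toWeakSpace ℝ X '' K n))
    {ε : ℕ → ℝ} (hε : Tendsto ε atTop (𝓝 0))
    (h : ∀ n, ∀ᶠ i in (U : Filter ι), ∃ k ∈ K n, ‖y i - k‖ ≤ ε n) :
    ∃ z, Tendsto (fun i => toWeakSpace ℝ X (y i)) U (𝓝 (toWeakSpace ℝ X z)) := by
  have hp : ∀ n, ∃ p : ι → X, ∀ᶠ i in (U : Filter ι), p i ∈ K n ∧ ‖y i - p i‖ ≤ ε n := by
    intro n
    obtain ⟨p, hp⟩ := (h n).choice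
    exact ⟨p, hp⟩
  choose p hp using hp
  have hz : ∀ n, ∃ z, Tendsto (fun i => toWeakSpace ℝ X (p n i)) U (𝓝 (toWeakSpace ℝ X z)) := by
    intro n
    obtain ⟨w, ⟨z, -, rfl⟩, hw⟩ := (hK n).ultrafilter_le_nhds
      (U.map fun i => toWeakSpace ℝ X (p n i)) (by
        rw [le_principal_iff]
        exact (hp n).mono fun i hi => mem_image_of_mem _ hi.1)
    exact ⟨z, hw⟩
  choose z hz using hz
  -- Closed balls are weakly closed, so norm bounds on `p n i - p m i` survive the weak limit.
  have hdist : ∀ n m, dist (z n) (z m) ≤ ε n + ε m := by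
    intro n m
    have hd : Tendsto (fun i => toWeakSpace ℝ X (p n i - p m i)) U
        (𝓝 (toWeakSpace ℝ X (z n - z m))) := by
      simpa only [map_sub] using (hz n).sub (hz m)
    have hmem := mem_of_tendsto_toWeakSpace (convex_closedBall (0 : X) (ε n + ε m))
      Metric.isClosed_closedBall hd (by
        filter_upwards [hp n, hp m] with i hn hm
        rw [mem_closedBall_zero_iff]
        calc ‖p n i - p m i‖ = ‖(y i - p m i) - (y i - p n i)‖ := by congr 1; abel
          _ ≤ ‖y i - p m i‖ + ‖y i - p n i‖ := norm_sub_le _ _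
          _ ≤ ε n + ε m := by linarith [hn.2, hm.2])
    rwa [mem_closedBall_zero_iff, ← dist_eq_norm] at hmem
  have hcau : CauchySeq z := by
    rw [Metric.cauchySeq_iff]
    intro δ hδ
    obtain ⟨N, hN⟩ := eventually_atTop.1 (hε.eventually (gt_mem_nhds (half_pos hδ)))
    exact ⟨N, fun m hm n hn => (hdist m n).trans_lt (by linarith [hN m hm, hN n hn])⟩
  obtain ⟨w, hw⟩ := cauchySeq_tendsto_of_complete hcau
  refine ⟨w, tendsto_toWeakSpace_iff.2 fun f => ?_⟩
  rw [Metric.tendsto_nhds]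
  intro δ hδ
  have h1 : ∀ᶠ n in atTop, ‖f‖ * ε n < δ / 3 := by
    have := hε.const_mul ‖f‖
    rw [mul_zero] at this
    exact this.eventually (gt_mem_nhds (by positivity))
  have h2 : ∀ᶠ n in atTop, dist (f (z n)) (f w) < δ / 3 :=
    Metric.tendsto_nhds.1 ((f.continuous.tendsto w).comp hw) _ (by positivity)
  obtain ⟨n, hn1, hn2⟩ := (h1.and h2).exists
  filter_upwards [hp n, Metric.tendsto_nhds.1 (tendsto_toWeakSpace_iff.1 (hz n) f) (δ / 3)
    (by positivity)] with i hi hi'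
  have h3 : dist (f (y i)) (f (p n i)) < δ / 3 := by
    rw [dist_eq_norm, ← map_sub]
    exact ((f.le_opNorm _).trans (mul_le_mul_of_nonneg_left hi.2 (norm_nonneg f))).trans_lt hn1
  have h4 := dist_triangle4 (f (y i)) (f (p n i)) (f (z n)) (f w)
  linarith

/-- A summand which is weakly compact can be cancelled from an inclusion of Minkowski sums into a
closed convex set. -/
theorem subset_of_add_subset_add {A C D : Set X} (hC : C.Nonempty)
    (hCc : IsCompact (toWeakSpace ℝ X '' C)) (hD : Convex ℝ D) (hDc : IsClosed D)
    (h : A + C ⊆ D + C) : A ⊆ D := by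
  intro a ha
  by_contra hna
  obtain ⟨f, u, hu, hau⟩ := geometric_hahn_banach_closed_point hD hDc hna
  let g : WeakSpace ℝ X → ℝ := fun w => f ((toWeakSpace ℝ X).symm w)
  have hg : Continuous g := WeakBilin.eval_continuous (topDualPairing ℝ X).flip f
  -- With `c` maximizing `f` on `C`, writing `a + c = d + c'` forces `f a ≤ f d`, against the
  -- separation.
  obtain ⟨_, ⟨c, hc, rfl⟩, hmax⟩ := hCc.exists_isMaxOn (hC.image _) hg.continuousOn
  obtain ⟨d, hd, c', hc', hdc⟩ := h (add_mem_add ha hc)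
  have h1 : f c' ≤ f c := hmax (mem_image_of_mem _ hc')
  have h2 := congrArg f hdc
  simp only [map_add] at h2
  linarith [hu d hd]

theorem add_mem_cwk {A B : Set X} (hA : A ∈ cwk X) (hB : B ∈ cwk X) : A + B ∈ cwk X := by
  refine ⟨hA.1.add hB.1, hA.2.1.add hB.2.1, ?_⟩
  rw [Set.image_add]
  exact hA.2.2.add hB.2.2

theorem zero_mem_cwk : (0 : Set X) ∈ cwk X := by
  refine ⟨⟨0, rfl⟩, convex_singleton 0, ?_⟩
  rw [← Set.singleton_zero, image_singleton]
  exact isCompact_singleton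

theorem smul_mem_cwk (c : ℝ) {A : Set X} (hA : A ∈ cwk X) : c • A ∈ cwk X := by
  refine ⟨hA.1.smul_set, hA.2.1.smul c, ?_⟩
  rw [Set.image_smul_comm _ _ _ (fun x => map_smul _ _ _)]
  exact hA.2.2.image (continuous_const_smul c)

theorem sum_mem_cwk {ι : Type*} (s : Finset ι) {A : ι → Set X} (hA : ∀ i, A i ∈ cwk X) :
    ∑ i ∈ s, A i ∈ cwk X := by
  classical
  induction s using Finset.induction_on with
  | empty => simpa using zero_mem_cwk
  | insert i s hi ih => rw [Finset.sum_insert hi]; exact add_mem_cwk (hA i) ih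

end WeakCompactness

/-! ### Order neighbourhoods and limits of Cauchy sequences in `cwk X` -/

section OrderNhd

variable {X : Type*} [NormedAddCommGroup X] [Lattice X]

theorem mem_orderNhd {C : Set X} {b z : X} : z ∈ orderNhd C b ↔ ∃ y ∈ C, |z - y| ≤ b := Iff.rfl

theorem IsOSeq.nonneg {b : ℕ → X} (hb : IsOSeq b) (n : ℕ) : 0 ≤ b n := hb.2.1 ⟨n, rfl⟩

theorem norm_le_of_abs_le [HasSolidNorm X] {x b : X} (h : |x| ≤ b) : ‖x‖ ≤ ‖b‖ :=
  norm_le_norm_of_abs_le_abs (h.trans (le_abs_self b))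

variable [IsOrderedAddMonoid X]

theorem abs_le_iff_mem_Icc {x b : X} : |x| ≤ b ↔ x ∈ Icc (-b) b := by
  rw [abs_le', mem_Icc, neg_le, and_comm]

theorem orderNhd_eq_add (C : Set X) (b : X) : orderNhd C b = C + Icc (-b) b := by
  ext z
  rw [mem_orderNhd, Set.mem_add]
  constructor
  · rintro ⟨y, hy, h⟩
    exact ⟨y, hy, z - y, abs_le_iff_mem_Icc.1 h, by abel⟩
  · rintro ⟨y, hy, r, hr, rfl⟩
    exact ⟨y, hy, by rw [add_sub_cancel_left]; exact abs_le_iff_mem_Icc.2 hr⟩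

theorem orderNhd_subset_orderNhd_add {A B C : Set X} {b c : X} (hAB : A ⊆ orderNhd B b)
    (hBC : B ⊆ orderNhd C c) : A ⊆ orderNhd C (b + c) := by
  intro a ha
  obtain ⟨y, hy, hay⟩ := hAB ha
  obtain ⟨z, hz, hyz⟩ := hBC hy
  refine ⟨z, hz, ?_⟩
  rw [abs_le_iff_mem_Icc, mem_Icc] at *
  rw [← sub_add_sub_cancel a y z, neg_add]
  exact ⟨add_le_add hay.1 hyz.1, add_le_add hay.2 hyz.2⟩

theorem IsOSeq.add_self {b : ℕ → X} (hb : IsOSeq b) : IsOSeq (b + b) := by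
  refine ⟨hb.1.add hb.1, ?_, ?_⟩
  · rintro _ ⟨n, rfl⟩
    exact add_nonneg (hb.nonneg n) (hb.nonneg n)
  · intro x hx
    -- Monotonicity decouples the two indices, so the infimum can be taken in each separately.
    have h1 : ∀ n m, x ≤ b n + b m := fun n m =>
      (hx ⟨max n m, rfl⟩).trans
        (add_le_add (hb.1 (le_max_left n m)) (hb.1 (le_max_right n m)))
    have h2 : ∀ m, x - b m ≤ 0 := fun m => hb.2.2 (by
      rintro _ ⟨n, rfl⟩
      exact sub_le_iff_le_add.2 (h1 n m))
    exact hb.2.2 (by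
      rintro _ ⟨m, rfl⟩
      exact sub_nonpos.1 (h2 m))

/-- This is where order continuity enters: it turns order estimates into norm approximation. -/
theorem IsOSeq.tendsto_norm [HasSolidNorm X] (hX : OrderContinuousNorm X) {b : ℕ → X} (hb : IsOSeq b) :
    Tendsto (fun n => ‖b n‖) atTop (𝓝 0) := by
  rw [Metric.tendsto_atTop]
  intro ε hε
  obtain ⟨_, ⟨N, rfl⟩, hN⟩ := hX (range b) (range_nonempty b)
    (by
      rintro _ ⟨n, rfl⟩ _ ⟨m, rfl⟩
      exact ⟨_, ⟨max n m, rfl⟩, hb.1 (le_max_left _ _), hb.1 (le_max_right _ _)⟩) hb.2 ε hε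
  refine ⟨N, fun n hn => ?_⟩
  rw [dist_zero_right, norm_norm]
  refine (norm_le_of_abs_le ?_).trans_lt hN
  rw [abs_of_nonneg (hb.nonneg n)]
  exact hb.1 hn

variable [NormedSpace ℝ X] [IsOrderedModule ℝ X]

theorem convex_orderNhd {C : Set X} (hC : Convex ℝ C) (b : X) : Convex ℝ (orderNhd C b) := by
  rw [orderNhd_eq_add]
  exact hC.add (convex_Icc _ _)

variable [HasSolidNorm X]

/-- A weakly compact set plus the weakly closed interval `Icc (-b) b` is weakly closed, hence norm
closed. -/
theorem isClosed_orderNhd {C : Set X} (hC : IsCompact (toWeakSpace ℝ X '' C)) (b : X) :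
    IsClosed (orderNhd C b) := by
  have h : IsClosed (toWeakSpace ℝ X '' orderNhd C b) := by
    rw [orderNhd_eq_add, Set.image_add]
    exact (isClosed_toWeakSpace_image (convex_Icc (-b) b) isClosed_Icc).add_left_of_isCompact hC
  have h' := h.preimage (toWeakSpaceCLM ℝ X).continuous
  have e : (toWeakSpaceCLM ℝ X) ⁻¹' (toWeakSpace ℝ X '' orderNhd C b) = orderNhd C b :=
    preimage_image_eq _ (toWeakSpace ℝ X).injective
  rwa [e] at h'

theorem abs_sub_le_of_tendsto_toWeakSpace {ι : Type*} {l : Filter ι} [l.NeBot] {y : ι → X}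
    {x z b : X} (hy : Tendsto (fun i => toWeakSpace ℝ X (y i)) l (𝓝 (toWeakSpace ℝ X z)))
    (h : ∀ᶠ i in l, |x - y i| ≤ b) : |x - z| ≤ b := by
  have hd : Tendsto (fun i => toWeakSpace ℝ X (x - y i)) l (𝓝 (toWeakSpace ℝ X (x - z))) := by
    simpa only [map_sub] using hy.const_sub (toWeakSpace ℝ X x)
  exact abs_le_iff_mem_Icc.2 (mem_of_tendsto_toWeakSpace (convex_Icc (-b) b) isClosed_Icc hd
    (h.mono fun i hi => abs_le_iff_mem_Icc.1 hi))

/-- A sequence in `cwk(X)` which is Cauchy with respect to an `(o)`-sequence has a limit. -/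
theorem exists_limit_of_cauchy [CompleteSpace X] (hX : OrderContinuousNorm X) {K : ℕ → Set X}
    (hK : ∀ n, K n ∈ cwk X) {b : ℕ → X} (hb : IsOSeq b)
    (hcau : ∀ n m, n ≤ m → K m ⊆ orderNhd (K n) (b n)) :
    ∃ J ∈ cwk X, ∀ n, ∀ A ∈ cwk X,
      (∀ m, n ≤ m → A ⊆ orderNhd (K m) (b n) ∧ K m ⊆ orderNhd A (b n)) →
        A ⊆ orderNhd J (b n) ∧ J ⊆ orderNhd A (b n) := by
  have hε := hb.tendsto_norm hX
  have hcl : ∀ n, IsClosed (orderNhd (K n) (b n)) := fun n => isClosed_orderNhd (hK n).2.2 _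
  have hcv : ∀ n, Convex ℝ (orderNhd (K n) (b n)) := fun n => convex_orderNhd (hK n).2.1 _
  have happ : ∀ n, ∀ x ∈ orderNhd (K n) (b n), ∃ k ∈ K n, ‖x - k‖ ≤ ‖b n‖ := by
    rintro n x ⟨k, hk, hxk⟩
    exact ⟨k, hk, norm_le_of_abs_le hxk⟩
  let U : Ultrafilter ℕ := hyperfilter ℕ
  have hU : ∀ n : ℕ, ∀ᶠ m in (U : Filter ℕ), n ≤ m := fun n =>
    Nat.hyperfilter_le_atTop (eventually_ge_atTop n)
  have hlim : ∀ y : ℕ → X, (∀ m, y m ∈ K m) → ∃ z ∈ ⋂ n, orderNhd (K n) (b n),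
      Tendsto (fun i => toWeakSpace ℝ X (y i)) U (𝓝 (toWeakSpace ℝ X z)) := by
    intro y hy
    have hev : ∀ n, ∀ᶠ i in (U : Filter ℕ), y i ∈ orderNhd (K n) (b n) := fun n =>
      (hU n).mono fun i hi => hcau n i hi (hy i)
    obtain ⟨z, hz⟩ := exists_tendsto_toWeakSpace_of_approx U (fun n => (hK n).2.2) hε
      fun n => (hev n).mono fun i hi => happ n _ hi
    exact ⟨z, mem_iInter.2 fun n => mem_of_tendsto_toWeakSpace (hcv n) (hcl n) hz (hev n), hz⟩
  refine ⟨⋂ n, orderNhd (K n) (b n), ⟨?_, convex_iInter hcv, ?_⟩, ?_⟩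
  · choose y hy using fun n => (hK n).1
    obtain ⟨z, hz, -⟩ := hlim y hy
    exact ⟨z, hz⟩
  · rw [isCompact_iff_ultrafilter_le_nhds]
    intro V hV
    rw [le_principal_iff] at hV
    have hV' : ∀ᶠ w in (V : Filter (WeakSpace ℝ X)),
        (toWeakSpace ℝ X).symm w ∈ ⋂ n, orderNhd (K n) (b n) := by
      filter_upwards [hV]
      rintro _ ⟨x, hx, rfl⟩
      simpa using hx
    obtain ⟨z, hz⟩ := exists_tendsto_toWeakSpace_of_approx V
      (y := fun w => (toWeakSpace ℝ X).symm w) (fun n => (hK n).2.2) hε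
      fun n => hV'.mono fun w hw => happ n _ (mem_iInter.1 hw n)
    refine ⟨_, mem_image_of_mem _ (mem_of_tendsto_toWeakSpace (convex_iInter hcv)
      (isClosed_iInter hcl) hz hV'), ?_⟩
    simpa only [LinearEquiv.apply_symm_apply] using tendsto_id'.1 hz
  · intro n A hA hAK
    constructor
    · intro x hx
      -- For `m < n` any point of `K m` will do, since only large `m` matter along `U`.
      have hy : ∀ m, ∃ y ∈ K m, n ≤ m → |x - y| ≤ b n := by
        intro m
        by_cases hm : n ≤ m
        · obtain ⟨y, hy, hxy⟩ := (hAK m hm).1 hx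
          exact ⟨y, hy, fun _ => hxy⟩
        · obtain ⟨y, hy⟩ := (hK m).1
          exact ⟨y, hy, fun h => absurd h hm⟩
      choose y hy hxy using hy
      obtain ⟨z, hzJ, hz⟩ := hlim y hy
      exact ⟨z, hzJ, abs_sub_le_of_tendsto_toWeakSpace hz ((hU n).mono hxy)⟩
    · intro x hx
      -- Membership in every neighbourhood yields points `y m` of `K m` converging to `x` in norm.
      choose y hy hxy using fun m => mem_iInter.1 hx m
      have hyx : Tendsto y atTop (𝓝 x) := by
        rw [tendsto_iff_norm_sub_tendsto_zero]
        refine squeeze_zero (fun _ => norm_nonneg _) (fun m => ?_) hε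
        rw [norm_sub_rev]
        exact norm_le_of_abs_le (hxy m)
      exact (isClosed_orderNhd hA.2.2 (b n)).mem_of_tendsto hyx
        ((eventually_ge_atTop n).mono fun m hm => (hAK m hm).2 (hy m))

end OrderNhd

/-! ### Gluing and existence of fine partitions -/

namespace Partition

variable {T : Type*} [MeasurableSpace T] {μ : MeasureTheory.Measure T}

/-- Partitions of a set and of its complement together form a partition of the whole space. -/
def glue {E : Set T} (P : Partition μ E) (Q : Partition μ Eᶜ) : Partition μ (univ : Set T) where
  size := P.size + Q.size
  part := Fin.append P.part Q.part
  tag := Fin.append P.tag Q.tag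
  measurableSet_part i := by
    refine Fin.addCases (fun i => ?_) (fun i => ?_) i
    · simpa using P.measurableSet_part i
    · simpa using Q.measurableSet_part i
  null_inter i j := by
    have hPQ : ∀ i j, P.part i ∩ Q.part j = ∅ := fun i j =>
      (disjoint_compl_right.mono ((subset_iUnion P.part i).trans P.iUnion_part.subset)
        ((subset_iUnion Q.part j).trans Q.iUnion_part.subset)).inter_eq
    refine Fin.addCases (fun i => ?_) (fun i => ?_) i <;>
      refine Fin.addCases (fun j => ?_) (fun j => ?_) j <;> intro hij
    · simpa using P.null_inter i j fun h => hij (by rw [h])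
    · simp [hPQ]
    · simp [inter_comm (Q.part i), hPQ]
    · simpa using Q.null_inter i j fun h => hij (by rw [h])
  iUnion_part := by
    refine eq_univ_of_forall fun x => ?_
    by_cases hx : x ∈ E
    · rw [← P.iUnion_part] at hx
      obtain ⟨i, hi⟩ := mem_iUnion.1 hx
      exact mem_iUnion.2 ⟨Fin.castAdd _ i, by simpa using hi⟩
    · have hx' : x ∈ Eᶜ := hx
      rw [← Q.iUnion_part] at hx'
      obtain ⟨i, hi⟩ := mem_iUnion.1 hx'
      exact mem_iUnion.2 ⟨Fin.natAdd _ i, by simpa using hi⟩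

theorem riemannSum_glue {X : Type*} [NormedAddCommGroup X] [NormedSpace ℝ X] {E : Set T}
    (P : Partition μ E) (Q : Partition μ Eᶜ) (F : T → cwk X) :
    (P.glue Q).riemannSum F = P.riemannSum F + Q.riemannSum F := by
  have h := Fin.sum_univ_add fun i : Fin (P.size + Q.size) =>
    μ.real (Fin.append P.part Q.part i) • (F (Fin.append P.tag Q.tag i) : Set X)
  simp only [Fin.append_left, Fin.append_right] at h
  exact h

theorem riemannSum_mem_cwk {X : Type*} [NormedAddCommGroup X] [NormedSpace ℝ X] {E : Set T}
    (P : Partition μ E) (F : T → cwk X) : P.riemannSum F ∈ cwk X :=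
  sum_mem_cwk _ fun i => smul_mem_cwk _ (F (P.tag i)).2

end Partition

namespace Partition

variable {T : Type*} [MetricSpace T] [MeasurableSpace T] {μ : MeasureTheory.Measure T}

theorem IsFine.mono {E : Set T} {P : Partition μ E} {γ δ : T → ℝ} (hP : P.IsFine γ)
    (h : ∀ t, γ t ≤ δ t) : P.IsFine δ := fun i w hw => (hP i w hw).trans_le (h _)

theorem IsFine.glue {E : Set T} {P : Partition μ E} {Q : Partition μ Eᶜ} {γ : T → ℝ}
    (hP : P.IsFine γ) (hQ : Q.IsFine γ) : (P.glue Q).IsFine γ := by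
  intro i
  refine Fin.addCases (fun i => ?_) (fun i => ?_) i
  · simpa [Partition.glue] using hP i
  · simpa [Partition.glue] using hQ i

/-- Tags are free, so it suffices to disjointify a finite cover by gauge balls and keep their
centres as tags. -/
theorem exists_isFine [CompactSpace T] [BorelSpace T] (μ : MeasureTheory.Measure T) {E : Set T}
    (hE : MeasurableSet E) {γ : T → ℝ} (hγ : IsGauge γ) : ∃ P : Partition μ E, P.IsFine γ := by
  obtain ⟨s, hs⟩ := CompactSpace.elim_nhds_subcover (fun t => Metric.ball t (γ t))
    fun t => Metric.ball_mem_nhds t (hγ t)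
  let t : Fin s.card → T := fun i => s.equivFin.symm i
  let B : Fin s.card → Set T := fun i => Metric.ball (t i) (γ (t i))
  have hB : ⋃ i, B i = univ := by
    refine eq_univ_of_forall fun x => ?_
    have hx : x ∈ ⋃ t ∈ s, Metric.ball t (γ t) := by rw [hs]; trivial
    obtain ⟨a, ha, hxa⟩ := mem_iUnion₂.1 hx
    exact mem_iUnion.2 ⟨s.equivFin ⟨a, ha⟩, by simpa [B, t] using hxa⟩
  refine ⟨⟨s.card, fun i => E ∩ disjointed B i, t, fun i => hE.inter ?_, fun i j hij => ?_, ?_⟩, ?_⟩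
  · exact disjointedRec (fun _ j ht => ht.diff Metric.isOpen_ball.measurableSet)
      Metric.isOpen_ball.measurableSet
  · rw [(((disjoint_disjointed B) hij).mono inter_subset_right inter_subset_right).inter_eq]
    exact MeasureTheory.measure_empty
  · rw [← inter_iUnion, iUnion_disjointed, hB, inter_univ]
  · intro i w hw
    exact disjointed_subset B i hw.2

end Partition

/-! ### The Cauchy criterion -/

section Cauchy

variable {T X : Type*} [MetricSpace T] [CompactSpace T] [MeasurableSpace T] [BorelSpace T]
  {μ : MeasureTheory.Measure T} [NormedAddCommGroup X] [NormedSpace ℝ X] [Lattice X]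
  [IsOrderedAddMonoid X] [IsOrderedModule ℝ X] [HasSolidNorm X]

/-- The Cauchy estimate for Riemann sums over the whole space passes to measurable subsets. -/
theorem riemannSum_subset_orderNhd_of_univ {F : T → cwk X} {γ : T → ℝ} (hγ : IsGauge γ) {b : X}
    (h : ∀ P P' : Partition μ (univ : Set T), P.IsFine γ → P'.IsFine γ →
      P.riemannSum F ⊆ orderNhd (P'.riemannSum F) b)
    {E : Set T} (hE : MeasurableSet E) {P P' : Partition μ E} (hP : P.IsFine γ)
    (hP' : P'.IsFine γ) : P.riemannSum F ⊆ orderNhd (P'.riemannSum F) b := by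
  obtain ⟨Q, hQ⟩ := Partition.exists_isFine μ hE.compl hγ
  have hQF := Q.riemannSum_mem_cwk F
  have hPF := P'.riemannSum_mem_cwk F
  refine subset_of_add_subset_add hQF.1 hQF.2.2 (convex_orderNhd hPF.2.1 b)
    (isClosed_orderNhd hPF.2.2 b) ?_
  have := h _ _ (hP.glue hQ) (hP'.glue hQ)
  rwa [Partition.riemannSum_glue, Partition.riemannSum_glue, orderNhd_eq_add,
    add_right_comm, ← orderNhd_eq_add] at this

theorem ohIntegrable_of_cauchy [CompleteSpace X] (hX : OrderContinuousNorm X) {F : T → cwk X}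
    {b : ℕ → X} (hb : IsOSeq b) {γ : ℕ → T → ℝ} (hγ : ∀ n, IsGauge (γ n))
    (h : ∀ n, ∀ P P' : Partition μ (univ : Set T), P.IsFine (γ n) → P'.IsFine (γ n) →
      P.riemannSum F ⊆ orderNhd (P'.riemannSum F) (b n)) : OHIntegrable μ F := by
  intro E hE
  -- The running minimum of the gauges makes `P m` fine for every `γ n` with `n ≤ m`.
  let δ : ℕ → T → ℝ := fun n t => (Finset.range (n + 1)).inf' ⟨0, by simp⟩ fun k => γ k t
  have hδ : ∀ n, IsGauge (δ n) := fun n t => (Finset.lt_inf'_iff _).2 fun k _ => hγ k t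
  have hδγ : ∀ n m, n ≤ m → ∀ t, δ m t ≤ γ n t := fun n m hnm t =>
    Finset.inf'_le _ (Finset.mem_range.2 (Nat.lt_succ_of_le hnm))
  have hE' : ∀ n, ∀ P P' : Partition μ E, P.IsFine (γ n) → P'.IsFine (γ n) →
      P.riemannSum F ⊆ orderNhd (P'.riemannSum F) (b n) := fun n P P' hP hP' =>
    riemannSum_subset_orderNhd_of_univ (hγ n) (h n) hE hP hP'
  choose P hP using fun n => Partition.exists_isFine μ hE (hδ n)
  have hPγ : ∀ n m, n ≤ m → (P m).IsFine (γ n) := fun n m hnm => (hP m).mono (hδγ n m hnm)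
  obtain ⟨J, hJ, hlim⟩ := exists_limit_of_cauchy hX (fun n => (P n).riemannSum_mem_cwk F) hb
    fun n m hnm => hE' n _ _ (hPγ n m hnm) (hPγ n n le_rfl)
  refine ⟨J, hJ, b, hb, γ, hγ, fun n Q hQ => hlim n _ (Q.riemannSum_mem_cwk F) fun m hnm => ?_⟩
  exact ⟨hE' n _ _ hQ (hPγ n m hnm), hE' n _ _ (hPγ n m hnm) hQ⟩

end Cauchy

theorem OHIntegrable.cauchy {T X : Type*} [MetricSpace T] [MeasurableSpace T]
    {μ : MeasureTheory.Measure T} [NormedAddCommGroup X] [NormedSpace ℝ X] [Lattice X]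
    [IsOrderedAddMonoid X] {F : T → cwk X} (hF : OHIntegrable μ F) :
    ∃ b : ℕ → X, IsOSeq b ∧ ∃ γ : ℕ → T → ℝ, (∀ n, IsGauge (γ n)) ∧
      ∀ n, ∀ P P' : Partition μ (univ : Set T), P.IsFine (γ n) → P'.IsFine (γ n) →
        P.riemannSum F ⊆ orderNhd (P'.riemannSum F) (b n) := by
  obtain ⟨J, -, b, hb, γ, hγ, h⟩ := hF univ MeasurableSet.univ
  exact ⟨b + b, hb.add_self, γ, hγ, fun n P P' hP hP' =>
    orderNhd_subset_orderNhd_add (h n P hP).1 (h n P' hP').2⟩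

end OrderHenstock

theorem lemma3p20 {T X : Type*} [MetricSpace T] [CompactSpace T] [MeasurableSpace T]
    [BorelSpace T] (μ : MeasureTheory.Measure T) [MeasureTheory.IsFiniteMeasure μ]
    [μ.Regular] [MeasureTheory.NullSingletonClass μ]
    [NormedAddCommGroup X] [NormedSpace ℝ X] [CompleteSpace X]
    [Lattice X] [IsOrderedAddMonoid X] [IsOrderedModule ℝ X] [HasSolidNorm X]
    (hX : OrderHenstock.OrderContinuousNorm X)
    (F : T → OrderHenstock.cwk X) :
    OrderHenstock.OHIntegrable μ F ↔
      ∃ b : ℕ → X, OrderHenstock.IsOSeq b ∧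
        ∃ γ : ℕ → T → ℝ, (∀ n, OrderHenstock.IsGauge (γ n)) ∧
          ∀ n, ∀ P P' : OrderHenstock.Partition μ (Set.univ : Set T),
            P.IsFine (γ n) → P'.IsFine (γ n) →
              P.riemannSum F ⊆ OrderHenstock.orderNhd (P'.riemannSum F) (b n) :=
  ⟨fun h => h.cauchy, fun ⟨_, hb, _, hγ, h⟩ => OrderHenstock.ohIntegrable_of_cauchy hX hb hγ h⟩
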